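/- **Definitions.** A hypergraph $G=(V,E)$ is a finite set $V$ of nodes with a set $E$ of subsets of $V$ of cardinality at least two. For $N\subseteq V$, $G-N$ is the hypergraph with node set $V\setminus N$ and edge set $\{e\setminus N : e\in E,\ |e\setminus N|\ge 2\}$; $N$ is a *nest-set* of $G$ if $\{e\setminus N : e\in E,\ e\cap N\ne\emptyset\}$ is totally ordered by inclusion; and $\mathrm{gap}(G,N)=\max\{|N|-|e\cap N| : e\in E,\ e\cap N\neq\emptyset\}$ (with $\mathrm{gap}(G,N)=0$ if no edge meets $N$). A *nest-set elimination order* of $G$ is a sequence $N_1,\dots,N_t$ of pairwise disjoint subsets of $V$ with union $V$ such that $N_i$ is a nest-set of $G-N_1-\dots-N_{i-1}$ for every $i$. The *nest-set gap* $\mathrm{nsg}(G)$ is the minimum, over all nest-set elimination orders of $G$, of $\max_i \mathrm{gap}(G-N_1-\dots-N_{i-1},N_i)$ (read as $0$ if $V=\emptyset$). A *signed hypergraph* $H=(V,S)$ is a finite set $V$ of nodes with a finite set $S$ of signed edges $s=(e,\eta_s)$, where $e\subseteq V$, $|e|\ge 2$ and $\eta_s:e\to\{-1,+1\}$. Its underlying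 hypergraph $G=(V,E)$ has $E=\{e : (e,\eta_s)\in S\}$, and its rank is the maximum cardinality of an edge. The *pseudo-Boolean polytope* $\mathrm{PBP}(H)$ is the convex hull of all $z\in\{0,1\}^{V\cup S}$ with $z_s=\prod_{v\in e}\sigma_s(z_v)$ for every $s=(e,\eta_s)\in S$, where $\sigma_s(z_v)=z_v$ if $\eta_s(v)=+1$ and $\sigma_s(z_v)=1-z_v$ if $\eta_s(v)=-1$. An *extended formulation* of $\mathrm{PBP}(H)$ is a finite system of linear inequalities in the variables $z\in\mathbb R^{V\cup S}$ and finitely many additional variables $y$ such that $\mathrm{PBP}(H)$ is the projection of its solution set to the $z$-space; its number of variables counts both $z$ and $y$. **Theorem.** 1. There is an absolute constant $C$ such that, for every signed hypergraph $H=(V,S)$ with $S\neq\emptyset$, of rank $r$, whose underlying hypergraph $G$ satisfies $\mathrm{nsg}(G)\le k$, $k\in\mathbb N$, the polytope $\mathrm{PBP}(H)$ has an extended formulation with at most $C\,r\,2^k\,|V|\,|S|$ variables and at most $C\,r\,2^k\,|V|\,|S|$ inequalities, all of whose coefficients and right-hand side constants are $0$ or $\pm1$. 2. In particular, the formulation has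 polynomial size if $k=O(\log\mathrm{poly}(|V|,|E|))$: for every constant $c\in\mathbb R$ and every polynomial $p$ in two variables with coefficients in $\mathbb N$ there is a polynomial $q$ in two variables with coefficients in $\mathbb N$ such that, for every signed hypergraph $H=(V,S)$ whose underlying hypergraph $G=(V,E)$ satisfies $\mathrm{nsg}(G)\le k$ for some $k\in\mathbb N$ with $k\le c\log p(|V|,|E|)$ (where $\log 0:=0$), the polytope $\mathrm{PBP}(H)$ has an extended formulation with at most $q(|V|,|S|)$ variables and at most $q(|V|,|S|)$ inequalities, all of whose coefficients and right-hand side constants are $0$ or $\pm1$. -/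

import Mathlib

/-!
Hypergraphs, nest-sets and the nest-set gap; signed hypergraphs and the pseudo-Boolean polytope;
extended formulations.
-/

namespace PseudoBoolean

/-- A hypergraph `G = (V, E)`: a finite set of nodes (inside an ambient type `α`) and a set of
subsets of `V` of cardinality at least two. (Mathlib's `Hypergraph` allows infinite vertex sets
and edges of any cardinality; finite sets are used here so that maxima and counts make sense.) -/
structure FinHypergraph (α : Type*) where
  nodes : Finset α
  edges : Finset (Finset α)
  subset_nodes : ∀ e ∈ edges, e ⊆ nodes
  two_le_card : ∀ e ∈ edges, 2 ≤ e.card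

namespace FinHypergraph

variable {α : Type*} [DecidableEq α]

/-- `gap(G, V') = max {|V'| - |e ∩ V'| : e ∈ E, e ∩ V' ≠ ∅}`
(and `0` if no edge meets `V'`). -/
def gap (G : FinHypergraph α) (V' : Finset α) : ℕ :=
  (G.edges.filter fun e => (e ∩ V').Nonempty).sup fun e => V'.card - (e ∩ V').card

/-- The hypergraph `G - N` with node set `V \ N` and edge set
`{e \ N : e ∈ E, |e \ N| ≥ 2}`. -/
def delete (G : FinHypergraph α) (N : Finset α) : FinHypergraph α where
  nodes := G.nodes \ N
  edges := (G.edges.image fun e => e \ N).filter fun f => 2 ≤ f.card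
  subset_nodes := by
    intro f hf
    obtain ⟨e, he, rfl⟩ := Finset.mem_image.1 (Finset.mem_filter.1 hf).1
    exact Finset.sdiff_subset_sdiff (G.subset_nodes e he) (Finset.Subset.refl N)
  two_le_card := fun _ hf => (Finset.mem_filter.1 hf).2

/-- `N ⊆ V` is a nest-set of `G` if `{e \ N : e ∈ E, e ∩ N ≠ ∅}` is totally ordered with
respect to inclusion. -/
def IsNestSet (G : FinHypergraph α) (N : Finset α) : Prop :=
  N ⊆ G.nodes ∧
    IsChain (· ⊆ ·) {f : Finset α | ∃ e ∈ G.edges, (e ∩ N).Nonempty ∧ e \ N = f}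

/-- `N₁, …, N_t` is a nest-set elimination order of `G`: `N₁` is a nest-set of `G`, `N₂` is a
nest-set of `G - N₁`, and so on, and no node is left at the end. As `N_i` consists of nodes of
`G - N₁ - ⋯ - N_{i-1}`, the `N_i` are pairwise disjoint, and their union is `V`. -/
def IsNestSetElimOrder : FinHypergraph α → List (Finset α) → Prop
  | G, [] => G.nodes = ∅
  | G, N :: L => G.IsNestSet N ∧ IsNestSetElimOrder (G.delete N) L

/-- The nest-set gap of `N₁, …, N_t`: the maximum over `i` of
`gap(G - N₁ - ⋯ - N_{i-1}, N_i)`. -/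
def nsgOf : FinHypergraph α → List (Finset α) → ℕ
  | _, [] => 0
  | G, N :: L => max (G.gap N) (nsgOf (G.delete N) L)

/-- Every hypergraph has a nest-set elimination order, so that the minimum in `nsg` is over a
nonempty set. -/
theorem exists_isNestSetElimOrder (G : FinHypergraph α) :
    ∃ L : List (Finset α), G.IsNestSetElimOrder L := by
  refine ⟨[G.nodes], ⟨Finset.Subset.refl _, ?_⟩, Finset.sdiff_self _⟩
  rintro _ ⟨e, he, -, rfl⟩ _ ⟨f, hf, -, rfl⟩ h
  exact absurd (by rw [Finset.sdiff_eq_empty_iff_subset.2 (G.subset_nodes e he),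
    Finset.sdiff_eq_empty_iff_subset.2 (G.subset_nodes f hf)]) h

/-- The nest-set gap of `G`: the minimum nest-set gap of a nest-set elimination order of `G`. -/
noncomputable def nsg (G : FinHypergraph α) : ℕ :=
  sInf {g : ℕ | ∃ L : List (Finset α), G.IsNestSetElimOrder L ∧ G.nsgOf L = g}

end FinHypergraph

/-- A signed edge `(e, η)`: a finite set `e` with a sign `η v ∈ {-1, +1}` for each `v ∈ e`. -/
structure SignedEdge (α : Type*) where
  edge : Finset α
  sign : {v // v ∈ edge} → ℤˣ

/-- A signed hypergraph `H = (V, S)`: a finite set of nodes and a set of signed edges (so there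
are no identical ones, while parallel ones are allowed), each on at least two nodes of `V`. -/
structure SignedHypergraph (α : Type*) where
  nodes : Finset α
  edges : Finset (SignedEdge α)
  subset_nodes : ∀ s ∈ edges, s.edge ⊆ nodes
  two_le_card : ∀ s ∈ edges, 2 ≤ s.edge.card

/-- The literal `σ_s(x)`: `x` for the sign `+1` and `1 - x` for the sign `-1`. -/
noncomputable def literal (η : ℤˣ) (x : ℝ) : ℝ := if η = 1 then x else 1 - x

namespace SignedHypergraph

variable {α : Type*}

/-- The underlying hypergraph: ignore the signs and drop parallel edges. -/
def underlying [DecidableEq α] (H : SignedHypergraph α) : FinHypergraph α where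
  nodes := H.nodes
  edges := H.edges.image SignedEdge.edge
  subset_nodes := by
    intro e he
    obtain ⟨s, hs, rfl⟩ := Finset.mem_image.1 he
    exact H.subset_nodes s hs
  two_le_card := by
    intro e he
    obtain ⟨s, hs, rfl⟩ := Finset.mem_image.1 he
    exact H.two_le_card s hs

/-- The rank: the maximum cardinality of an edge. -/
def rank (H : SignedHypergraph α) : ℕ := H.edges.sup fun s => s.edge.card

/-- The index set `V ∪ S` (a disjoint union) of the coordinates of the pseudo-Boolean polytope. -/
abbrev Coord (H : SignedHypergraph α) : Type _ :=
  {v // v ∈ H.nodes} ⊕ {s // s ∈ H.edges}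

/-- The pseudo-Boolean set
`{z ∈ {0,1}^(V ∪ S) : z_s = ∏_{v ∈ s} σ_s(z_v) for all s ∈ S}`. -/
def pseudoBooleanSet (H : SignedHypergraph α) : Set (H.Coord → ℝ) :=
  {z | (∀ i, z i = 0 ∨ z i = 1) ∧
    ∀ s : {s // s ∈ H.edges}, z (Sum.inr s) =
      ∏ v : {v // v ∈ s.1.edge},
        literal (s.1.sign v) (z (Sum.inl ⟨v.1, H.subset_nodes s.1 s.2 v.2⟩))}

/-- The pseudo-Boolean polytope `PBP(H)`, the convex hull of the pseudo-Boolean set. -/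
def pseudoBooleanPolytope (H : SignedHypergraph α) : Set (H.Coord → ℝ) :=
  convexHull ℝ H.pseudoBooleanSet

end SignedHypergraph

/-- An extended formulation of `P ⊆ ℝ^ι`: a finite system of linear inequalities
`A z + B y ≤ b` in the variables `z ∈ ℝ^ι` and finitely many additional variables `y`, such that
`P` is the projection of its solution set to the `z`-space. (An equation is a pair of
inequalities.) -/
structure ExtendedFormulation {ι : Type*} [Fintype ι] (P : Set (ι → ℝ)) where
  numExtra : ℕ
  numIneqs : ℕ
  A : Matrix (Fin numIneqs) ι ℝ
  B : Matrix (Fin numIneqs) (Fin numExtra) ℝ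
  b : Fin numIneqs → ℝ
  mem_iff : ∀ z : ι → ℝ,
    z ∈ P ↔ ∃ y : Fin numExtra → ℝ, ∀ i, (A.mulVec z + B.mulVec y) i ≤ b i

namespace ExtendedFormulation

variable {ι : Type*} [Fintype ι] {P : Set (ι → ℝ)}

/-- The number of variables of an extended formulation, original and additional ones. -/
def numVars (F : ExtendedFormulation P) : ℕ := Fintype.card ι + F.numExtra

/-- All coefficients and right-hand sides are `0` or `±1`. -/
def IsZeroPmOne (F : ExtendedFormulation P) : Prop :=
  (∀ i j, F.A i j ∈ ({-1, 0, 1} : Set ℝ)) ∧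
  (∀ i j, F.B i j ∈ ({-1, 0, 1} : Set ℝ)) ∧
  ∀ i, F.b i ∈ ({-1, 0, 1} : Set ℝ)

end ExtendedFormulation

end PseudoBoolean

namespace PseudoBoolean

open Finset

/-! ### Rooted forests of finite sets -/

section Forest

variable {β : Type*} [DecidableEq β]

/-! A point of the polytope is a moment vector: for some probability measure on the 0/1 points, it
lists the probabilities that each node is 1 and that each signed edge, read as a conjunction of
literals (a term), is true. The formulation has one variable `y f` for each of a suitable family of
terms. Its completeness is proved by rebuilding such a measure one node at a time.

Suppose a measure on the points over `W` is known, and a node `v` is added whose terms have the form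
`g` plus a literal of `v`, with `g` in a forest: at every point, the terms of the forest that hold
form a chain. Every point then has a deepest term, and the probability that it is `g` is the excess
of `y` at `g`, i.e. `y g` minus the values at the children of `g`. Require that the two extensions
of `g` by a literal of `v` sum to `y g`, and that the excesses of both extended families are
nonnegative. Given the deepest term `g`, the value of `v` is drawn with the ratio of these excesses
as its probability. Excesses telescope, so all moments come out right (`exists_isProb_insert`), and
`HasSystem.insert_node` records the cost.

Terms holding at a common point are nested once their domains are, so nested domains yield forests.
A nest-set `N` only makes domains nested outside `N`. Each term meeting `N` is therefore written as
the sum of its at most `2 ^ gap` extensions to all of `N` (`HasSystem.of_extensions`). The extended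
domains are nested, and remain so while the nodes of `N` are peeled off (`HasSystem.union_nodes`).
Each node costs `O(2 ^ k * |S|)`, and `hasSystem_of_elimOrder` adds this up along the elimination
order. -/

theorem sup_id_mem_of_chain {S : Finset (Finset β)} (hne : S.Nonempty)
    (hS : ∀ f ∈ S, ∀ g ∈ S, f ⊆ g ∨ g ⊆ f) : S.sup id ∈ S := by
  obtain ⟨m, hm, hmax⟩ := S.exists_max_image card hne
  have h : S.sup id = m := by
    refine le_antisymm (Finset.sup_le fun f hf => ?_) (Finset.le_sup (f := id) hm)
    rcases hS f hf m hm with h | h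
    · exact h
    · exact (Finset.eq_of_subset_of_card_le h (hmax f hf)).ge
  rwa [h]

/-- A family containing `∅` in which the members contained in a given member form a chain. -/
structure IsForest (F : Finset (Finset β)) : Prop where
  empty_mem : ∅ ∈ F
  chain : ∀ h ∈ F, ∀ f ∈ F, ∀ g ∈ F, f ⊆ h → g ⊆ h → f ⊆ g ∨ g ⊆ f

/-- The largest member of `F` strictly contained in `h`. -/
def parent (F : Finset (Finset β)) (h : Finset β) : Finset β := (F.filter (· ⊂ h)).sup id

/-- The root must be excluded: `parent F ∅` is the empty supremum `∅`, so `∅` would be its own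
child. -/
def children (F : Finset (Finset β)) (g : Finset β) : Finset (Finset β) :=
  F.filter fun h => h ≠ ∅ ∧ parent F h = g

/-- The value of `y` at `g` minus its values at the children of `g`. -/
def excess (F : Finset (Finset β)) (y : Finset β → ℝ) (g : Finset β) : ℝ :=
  y g - ∑ h ∈ children F g, y h

variable {F : Finset (Finset β)}

theorem parent_mem_filter (hF : IsForest F) {h : Finset β} (hh : h ∈ F) (h0 : h ≠ ∅) :
    parent F h ∈ F.filter (· ⊂ h) := by
  refine sup_id_mem_of_chain
    ⟨∅, mem_filter.2 ⟨hF.empty_mem, (nonempty_iff_ne_empty.2 h0).empty_ssubset⟩⟩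
    fun f hf g hg => ?_
  rw [mem_filter] at hf hg
  exact hF.chain h hh f hf.1 g hg.1 hf.2.subset hg.2.subset

theorem subset_parent_iff (hF : IsForest F) {f h : Finset β} (hf : f ∈ F) (hh : h ∈ F)
    (h0 : h ≠ ∅) : f ⊆ parent F h ↔ f ⊂ h :=
  ⟨fun hfp => hfp.trans_ssubset (mem_filter.1 (parent_mem_filter hF hh h0)).2,
    fun hfh => Finset.le_sup (f := id) (mem_filter.2 ⟨hf, hfh⟩)⟩

/-- Telescoping: each member strictly above `f` is a child of exactly one member above `f`, namely
its parent, so every term except `y f` cancels. -/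
theorem sum_excess (hF : IsForest F) (y : Finset β → ℝ) {f : Finset β} (hf : f ∈ F) :
    ∑ g ∈ F.filter (f ⊆ ·), excess F y g = y f := by
  have key : ∑ g ∈ F.filter (f ⊆ ·), ∑ h ∈ children F g, y h = ∑ h ∈ F.filter (f ⊂ ·), y h := by
    rw [← sum_fiberwise_of_maps_to (s := F.filter (f ⊂ ·)) (t := F.filter (f ⊆ ·))
      (g := parent F)]
    · refine sum_congr rfl fun g hg => sum_congr ?_ fun _ _ => rfl
      ext h
      simp only [children, mem_filter] at hg ⊢
      constructor
      · rintro ⟨hh, h0, rfl⟩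
        exact ⟨⟨hh, (subset_parent_iff hF hf hh h0).1 hg.2⟩, rfl⟩
      · rintro ⟨⟨hh, hlt⟩, rfl⟩
        exact ⟨hh, (f.empty_subset.trans_ssubset hlt).ne', rfl⟩
    · intro h hh
      rw [mem_filter] at hh ⊢
      have h0 : h ≠ ∅ := (f.empty_subset.trans_ssubset hh.2).ne'
      exact ⟨(mem_filter.1 (parent_mem_filter hF hh.1 h0)).1,
        (subset_parent_iff hF hf hh.1 h0).2 hh.2⟩
  have split : F.filter (f ⊆ ·) = insert f (F.filter (f ⊂ ·)) := by
    ext g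
    simp only [mem_filter, mem_insert]
    constructor
    · rintro ⟨hg, h⟩
      rcases eq_or_ssubset_of_subset h with h | h
      · exact Or.inl h.symm
      · exact Or.inr ⟨hg, h⟩
    · rintro (rfl | ⟨hg, h⟩)
      · exact ⟨hf, Subset.rfl⟩
      · exact ⟨hg, h.subset⟩
  simp only [excess]
  rw [sum_sub_distrib, key, split, sum_insert (by simp)]
  ring

/-- Möbius inversion: at a largest set where `a` and `b` differ, all strictly larger members
contribute equally to both sums and cancel. -/
theorem eq_of_sum_superset_eq {a b : Finset β → ℝ}
    (hab : ∀ f ∈ F, ∑ g ∈ F.filter (f ⊆ ·), a g = ∑ g ∈ F.filter (f ⊆ ·), b g) :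
    ∀ f ∈ F, a f = b f := by
  by_contra! hne
  obtain ⟨f₀, hf₀, hne₀⟩ := hne
  obtain ⟨f, hf, hmax⟩ := (F.filter fun f => a f ≠ b f).exists_max_image card
    ⟨f₀, mem_filter.2 ⟨hf₀, hne₀⟩⟩
  rw [mem_filter] at hf
  have h := hab f hf.1
  have hmem : f ∈ F.filter (f ⊆ ·) := mem_filter.2 ⟨hf.1, Subset.rfl⟩
  rw [← add_sum_erase _ _ hmem, ← add_sum_erase _ _ hmem] at h
  refine hf.2 (add_right_cancel (h.trans (congrArg _ (sum_congr rfl fun g hg => ?_))))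
  rw [mem_erase, mem_filter] at hg
  by_contra hg'
  exact hg.1 (Finset.eq_of_subset_of_card_le hg.2.2
    (hmax g (mem_filter.2 ⟨hg.2.1, fun h => hg' h.symm⟩))).symm

theorem excess_eq_of_sum (hF : IsForest F) {y ν : Finset β → ℝ}
    (h : ∀ f ∈ F, ∑ g ∈ F.filter (f ⊆ ·), ν g = y f) : ∀ g ∈ F, excess F y g = ν g :=
  eq_of_sum_superset_eq fun f hf => (sum_excess hF y hf).trans (h f hf).symm

end Forest

/-! ### Terms, moments and systems -/

section Term

variable {α : Type*} [DecidableEq α]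

/-- The 0/1 point with support `A` satisfies all literals of the term `f`. -/
def Holds (A : Finset α) (f : Finset (α × Bool)) : Prop := ∀ p ∈ f, p.2 = decide (p.1 ∈ A)

instance (A : Finset α) (f : Finset (α × Bool)) : Decidable (Holds A f) :=
  inferInstanceAs (Decidable (∀ p ∈ f, p.2 = decide (p.1 ∈ A)))

/-- The value of the term `f` at the 0/1 point with support `A`. -/
def value (A : Finset α) (f : Finset (α × Bool)) : ℝ := if Holds A f then 1 else 0

/-- The set of variables of a term. -/
def dom (f : Finset (α × Bool)) : Finset α := f.image Prod.fst

/-- The part of the term `f` on variables outside `N`. -/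
def restrict (N : Finset α) (f : Finset (α × Bool)) : Finset (α × Bool) :=
  f.filter fun p => p.1 ∉ N

/-- The expectation of `f` with respect to the weights `μ` on the subsets of `V`. -/
def moment (V : Finset α) (μ : Finset α → ℝ) (f : Finset (α × Bool)) : ℝ :=
  ∑ A ∈ V.powerset, μ A * value A f

/-- The terms in `T`, the empty term and the literals of `V`. -/
def closedTerms (V : Finset α) (T : Finset (Finset (α × Bool))) : Set (Finset (α × Bool)) :=
  {f | f ∈ T ∨ f = ∅ ∨ ∃ v ∈ V, ∃ b, f = {(v, b)}}

structure IsProb (V : Finset α) (μ : Finset α → ℝ) : Prop where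
  nonneg : ∀ A, 0 ≤ μ A
  sum_eq : ∑ A ∈ V.powerset, μ A = 1

/-- The inequality `∑_{f ∈ P} y_f ≤ ∑_{f ∈ Q} y_f` coded by the pair `c = (P, Q)`. -/
def Satisfies (y : Finset (α × Bool) → ℝ)
    (c : Finset (Finset (α × Bool)) × Finset (Finset (α × Bool))) : Prop :=
  ∑ f ∈ c.1, y f ≤ ∑ f ∈ c.2, y f

/-- A linear system in the variables `y_f`, `f ∈ X`, which is valid for all 0/1 points and whose
solutions with `y_∅ = 1` are moments of a probability measure, as far as `closedTerms V T` is
concerned. -/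
structure IsSystem (V : Finset α) (T : Finset (Finset (α × Bool)))
    (X : Finset (Finset (α × Bool)))
    (L : Finset (Finset (Finset (α × Bool)) × Finset (Finset (α × Bool)))) : Prop where
  supp : ∀ c ∈ L, c.1 ⊆ X ∧ c.2 ⊆ X
  mem : ∀ f ∈ closedTerms V T, f ∈ X
  sound : ∀ A, ∀ c ∈ L, Satisfies (value A) c
  complete : ∀ y : Finset (α × Bool) → ℝ, y ∅ = 1 → (∀ c ∈ L, Satisfies y c) →
    ∃ μ, IsProb V μ ∧ ∀ f ∈ closedTerms V T, y f = moment V μ f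

def HasSystem (V : Finset α) (T : Finset (Finset (α × Bool))) (x l : ℕ) : Prop :=
  ∃ X L, IsSystem V T X L ∧ X.card ≤ x ∧ L.card ≤ l

theorem Holds.mono {A : Finset α} {f g : Finset (α × Bool)} (hg : Holds A g) (h : f ⊆ g) :
    Holds A f := fun p hp => hg p (h hp)

@[simp] theorem holds_empty (A : Finset α) : Holds A ∅ := by simp [Holds]

@[simp] theorem value_empty (A : Finset α) : value A ∅ = 1 := by simp [value]

theorem holds_insert {A : Finset α} {p : α × Bool} {f : Finset (α × Bool)} :
    Holds A (insert p f) ↔ p.2 = decide (p.1 ∈ A) ∧ Holds A f := by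
  simp [Holds]

theorem holds_congr {A B : Finset α} {f : Finset (α × Bool)}
    (h : ∀ a ∈ dom f, a ∈ A ↔ a ∈ B) : Holds A f ↔ Holds B f := by
  refine forall₂_congr fun p hp => ?_
  simp only [h p.1 (mem_image_of_mem _ hp)]

theorem value_congr {A B : Finset α} {f : Finset (α × Bool)}
    (h : ∀ a ∈ dom f, a ∈ A ↔ a ∈ B) : value A f = value B f := by
  simp only [value, holds_congr h]

/-- A term true at `A` is determined by its domain, since `A` dictates every sign. This turns nested
domains into nested terms. -/
theorem subset_of_holds {A : Finset α} {f g : Finset (α × Bool)} (hf : Holds A f)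
    (hg : Holds A g) (h : dom f ⊆ dom g) : f ⊆ g := by
  rintro ⟨a, b⟩ hp
  obtain ⟨⟨a', b'⟩, hq, rfl⟩ := mem_image.1 (h (mem_image_of_mem _ hp))
  have h1 := hf _ hp
  have h2 := hg _ hq
  dsimp only at h1 h2
  rwa [h1, ← h2]

theorem dom_restrict (N : Finset α) (f : Finset (α × Bool)) :
    dom (restrict N f) = dom f \ N := by
  ext a
  simp only [dom, restrict, mem_image, mem_filter, mem_sdiff]
  constructor
  · rintro ⟨p, ⟨hp, hn⟩, rfl⟩
    exact ⟨⟨p, hp, rfl⟩, hn⟩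
  · rintro ⟨⟨p, hp, rfl⟩, hn⟩
    exact ⟨p, ⟨hp, hn⟩, rfl⟩

/-- A satisfiable term has only one literal per variable. Hence discarding small terms matches
discarding small edges. -/
theorem card_dom {A : Finset α} {f : Finset (α × Bool)} (h : Holds A f) :
    (dom f).card = f.card := by
  refine card_image_of_injOn fun p hp q hq hpq => Prod.ext hpq ?_
  rw [h p hp, h q hq, hpq]

theorem restrict_subset (N : Finset α) (f : Finset (α × Bool)) : restrict N f ⊆ f :=
  filter_subset _ _

theorem restrict_empty (f : Finset (α × Bool)) : restrict ∅ f = f := by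
  simp [restrict]

theorem hasSystem_empty : HasSystem (∅ : Finset α) ∅ 1 0 := by
  refine ⟨{∅}, ∅, ⟨by simp, ?_, by simp, fun y hy _ => ⟨fun _ => 1, ⟨by simp, by simp⟩, ?_⟩⟩,
    by simp, by simp⟩
  · rintro f (h | rfl | ⟨v, h, -⟩)
    · simp at h
    · simp
    · simp at h
  · rintro f (h | rfl | ⟨v, h, -⟩)
    · simp at h
    · simp [hy, moment]
    · simp at h

end Term

/-! ### Gluing along a forest of terms -/

section Glue

variable {α : Type*} [DecidableEq α]

/-- The largest term of `F` that holds at `A`. -/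
def deepest (F : Finset (Finset (α × Bool))) (A : Finset α) : Finset (α × Bool) :=
  (F.filter (Holds A)).sup id

/-- A family of satisfiable terms, containing `∅`, in which the terms that hold at a given point
form a chain. -/
structure IsTermForest (F : Finset (Finset (α × Bool))) : Prop where
  empty_mem : ∅ ∈ F
  sat : ∀ f ∈ F, ∃ A, Holds A f
  chain : ∀ A, ∀ f ∈ F, ∀ g ∈ F, Holds A f → Holds A g → f ⊆ g ∨ g ⊆ f

variable {F : Finset (Finset (α × Bool))}

theorem IsTermForest.isForest (hF : IsTermForest F) : IsForest F where
  empty_mem := hF.empty_mem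
  chain h hh f hf g hg hfh hgh := by
    obtain ⟨A, hA⟩ := hF.sat h hh
    exact hF.chain A f hf g hg (hA.mono hfh) (hA.mono hgh)

theorem deepest_mem_filter (hF : IsTermForest F) (A : Finset α) :
    deepest F A ∈ F.filter (Holds A) := by
  refine sup_id_mem_of_chain ⟨∅, mem_filter.2 ⟨hF.empty_mem, holds_empty A⟩⟩ fun f hf g hg => ?_
  rw [mem_filter] at hf hg
  exact hF.chain A f hf.1 g hg.1 hf.2 hg.2

theorem deepest_mem (hF : IsTermForest F) (A : Finset α) : deepest F A ∈ F :=
  (mem_filter.1 (deepest_mem_filter hF A)).1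

theorem subset_deepest_iff (hF : IsTermForest F) {A : Finset α} {f : Finset (α × Bool)}
    (hf : f ∈ F) : f ⊆ deepest F A ↔ Holds A f :=
  ⟨(mem_filter.1 (deepest_mem_filter hF A)).2.mono,
    fun h => Finset.le_sup (f := id) (mem_filter.2 ⟨hf, h⟩)⟩

/-- Group the points by their deepest term; `f` holds at `A` exactly when `f` lies below the deepest
term of `A`. -/
theorem sum_deepest (hF : IsTermForest F) (P : Finset (Finset α)) (μ : Finset α → ℝ)
    (c : Finset (α × Bool) → ℝ) {f : Finset (α × Bool)} (hf : f ∈ F) :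
    ∑ g ∈ F.filter (f ⊆ ·), c g * ∑ A ∈ P.filter (deepest F · = g), μ A =
      ∑ A ∈ P, μ A * (c (deepest F A) * value A f) := by
  have h1 : ∀ A, μ A * (c (deepest F A) * value A f) =
      if f ⊆ deepest F A then c (deepest F A) * μ A else 0 := by
    intro A
    simp only [value, subset_deepest_iff hF hf]
    split_ifs <;> ring
  simp only [h1]
  rw [← sum_filter, ← sum_fiberwise_of_maps_to (s := P.filter (f ⊆ deepest F ·))
    (t := F.filter (f ⊆ ·)) (g := deepest F)]
  · refine sum_congr rfl fun g hg => ?_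
    rw [mul_sum, filter_filter]
    refine sum_congr ?_ fun A hA => ?_
    · refine filter_congr fun A _ => ⟨?_, And.right⟩
      rintro rfl
      exact ⟨(mem_filter.1 hg).2, rfl⟩
    · rw [(mem_filter.1 hA).2.2]
  · intro A hA
    exact mem_filter.2 ⟨deepest_mem hF A, (mem_filter.1 hA).2⟩

/-- The excess is the probability that `g` is the deepest true term: both functions have the same
sums over supersets. -/
theorem excess_moment (hF : IsTermForest F) {W : Finset α} {μ : Finset α → ℝ}
    {y : Finset (α × Bool) → ℝ} (hy : ∀ f ∈ F, y f = moment W μ f) :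
    ∀ g ∈ F, excess F y g = ∑ A ∈ W.powerset.filter (deepest F · = g), μ A := by
  refine excess_eq_of_sum hF.isForest fun f hf => ?_
  have := sum_deepest hF W.powerset μ (fun _ => 1) hf
  simpa only [one_mul, hy f hf, moment] using this

/-- Conditional probabilities. The second one is defined as the complement of the first, so they sum
to one even where `e` vanishes; there both `d` vanish on `s` and any split works. -/
theorem exists_split {ι : Type*} {s : Set ι} {e : ι → ℝ} {d : Bool → ι → ℝ}
    (hd : ∀ b, ∀ i ∈ s, 0 ≤ d b i) (he : ∀ i ∈ s, d true i + d false i = e i) :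
    ∃ ρ : Bool → ι → ℝ, (∀ b, ∀ i ∈ s, 0 ≤ ρ b i) ∧ (∀ i, ρ true i + ρ false i = 1) ∧
      ∀ b, ∀ i ∈ s, ρ b i * e i = d b i := by
  refine ⟨fun b i => bif b then d true i / e i else 1 - d true i / e i, ?_, by simp, ?_⟩
  · intro b i hi
    have h0 := hd true i hi
    have h1 := hd false i hi
    have h2 := he i hi
    cases b
    · have : d true i / e i ≤ 1 := div_le_one_of_le₀ (by linarith) (by linarith)
      simpa using this
    · exact div_nonneg h0 (by linarith)
  · intro b i hi
    have h0 := hd true i hi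
    have h1 := hd false i hi
    have h2 := he i hi
    have h3 : d true i / e i * e i = d true i := by
      by_cases h : e i = 0
      · have : d true i = 0 := by linarith
        simp [this]
      · field_simp
    cases b
    · simp only [cond_false, sub_mul, h3]
      linarith
    · simpa using h3

theorem exists_isProb_insert {v : α} {W : Finset α} (hv : v ∉ W) (hF : IsTermForest F)
    (hvF : ∀ f ∈ F, v ∉ dom f) {y : Finset (α × Bool) → ℝ} {μ' : Finset α → ℝ}
    (hμ' : IsProb W μ') (hy : ∀ f ∈ F, y f = moment W μ' f)
    (hadd : ∀ f ∈ F, y (insert (v, true) f) + y (insert (v, false) f) = y f)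
    (hpos : ∀ b, ∀ f ∈ F, 0 ≤ excess F (fun g => y (insert (v, b) g)) f) :
    ∃ μ, IsProb (insert v W) μ ∧
      (∀ f, v ∉ dom f → moment (insert v W) μ f = moment W μ' f) ∧
      ∀ b, ∀ f ∈ F, y (insert (v, b) f) = moment (insert v W) μ (insert (v, b) f) := by
  obtain ⟨ρ, hρ0, hρ1, hρ⟩ := exists_split (s := {f | f ∈ F}) (e := excess F y) hpos (by
    intro g hg
    have h : ∑ h ∈ children F g, y h = ∑ h ∈ children F g, y (insert (v, true) h) +
        ∑ h ∈ children F g, y (insert (v, false) h) := by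
      rw [← sum_add_distrib]
      exact sum_congr rfl fun h hh => (hadd h (mem_filter.1 hh).1).symm
    simp only [excess, ← hadd g hg, h]
    ring)
  -- The value of `v` is drawn with a probability that depends on the old point only through its
  -- deepest term.
  set μ : Finset α → ℝ := fun B =>
    μ' (B.erase v) * ρ (decide (v ∈ B)) (deepest F (B.erase v)) with hμ
  have hsum : ∀ f, moment (insert v W) μ f = ∑ A ∈ W.powerset, μ' A *
      (ρ false (deepest F A) * value A f + ρ true (deepest F A) * value (insert v A) f) := by
    intro f
    rw [moment, sum_powerset_insert hv, ← sum_add_distrib]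
    refine sum_congr rfl fun A hA => ?_
    have hvA : v ∉ A := fun h => hv (mem_powerset.1 hA h)
    simp only [hμ, erase_eq_of_notMem hvA, erase_insert hvA, hvA, mem_insert_self, decide_true,
      decide_false]
    ring
  have hout : ∀ f, v ∉ dom f → moment (insert v W) μ f = moment W μ' f := by
    intro f hf
    rw [hsum, moment]
    refine sum_congr rfl fun A _ => ?_
    rw [value_congr (A := insert v A) (B := A), ← add_mul, add_comm, hρ1, one_mul]
    intro a ha
    have : a ≠ v := fun h => hf (h ▸ ha)
    simp [this]
  refine ⟨μ, ⟨fun A => mul_nonneg (hμ'.nonneg _) (hρ0 _ _ (deepest_mem hF _)), ?_⟩, hout, ?_⟩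
  · have := hout ∅ (by simp [dom])
    simpa [moment, hμ'.sum_eq] using this
  · intro b f hf
    -- By the choice of `ρ`, each summand is the excess of the family extended by `(v, b)`, and
    -- these excesses telescope.
    have h1 : ∑ g ∈ F.filter (f ⊆ ·), ρ b g * ∑ A ∈ W.powerset.filter (deepest F · = g), μ' A =
        y (insert (v, b) f) := by
      rw [← sum_excess hF.isForest (fun g => y (insert (v, b) g)) hf]
      refine sum_congr rfl fun g hg => ?_
      have hg := (mem_filter.1 hg).1
      rw [← excess_moment hF hy g hg, hρ b g hg]
    rw [← h1, sum_deepest hF _ _ _ hf, hsum]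
    refine sum_congr rfl fun A hA => ?_
    have hvA : v ∉ A := fun h => hv (mem_powerset.1 hA h)
    have h2 : value (insert v A) f = value A f := value_congr fun a ha => by
      have : a ≠ v := fun h => hvF f hf (h ▸ ha)
      simp [this]
    simp only [value] at h2
    cases b <;> simp [value, holds_insert, hvA, h2]

end Glue

/-! ### Operations on systems -/

section System

variable {α : Type*} [DecidableEq α]

theorem dom_subset_of_mem_closedTerms {W : Finset α} {T : Finset (Finset (α × Bool))}
    (hT : ∀ f ∈ T, dom f ⊆ W) {f : Finset (α × Bool)} (hf : f ∈ closedTerms W T) :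
    dom f ⊆ W := by
  rcases hf with h | rfl | ⟨v, h, b, rfl⟩
  · exact hT f h
  · simp [dom]
  · simpa [dom] using h

theorem not_mem_of_not_mem_dom {v : α} {f : Finset (α × Bool)} (h : v ∉ dom f) (b : Bool) :
    (v, b) ∉ f := fun hp => h (mem_image_of_mem Prod.fst hp)

theorem insert_injOn {F : Finset (Finset (α × Bool))} {v : α} (hvF : ∀ f ∈ F, v ∉ dom f)
    (b : Bool) : Set.InjOn (fun g : Finset (α × Bool) => insert (v, b) g) F := by
  intro f hf g hg hfg
  have := congrArg (fun h => h.erase (v, b)) hfg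
  simpa [erase_insert (not_mem_of_not_mem_dom (hvF f hf) b),
    erase_insert (not_mem_of_not_mem_dom (hvF g hg) b)] using this

theorem satisfies_children_iff {F : Finset (Finset (α × Bool))} {v : α}
    (hvF : ∀ f ∈ F, v ∉ dom f) (b : Bool) (y : Finset (α × Bool) → ℝ) (g : Finset (α × Bool)) :
    Satisfies y ((children F g).image (fun h => insert (v, b) h), {insert (v, b) g}) ↔
      0 ≤ excess F (fun h => y (insert (v, b) h)) g := by
  have hinj : Set.InjOn (fun h : Finset (α × Bool) => insert (v, b) h) (children F g) :=
    (insert_injOn hvF b).mono (coe_subset.2 (filter_subset _ _))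
  rw [Satisfies, sum_singleton, sum_image hinj, excess, sub_nonneg]

theorem sum_insert_pair {v : α} {f : Finset (α × Bool)} (h : v ∉ dom f)
    (y : Finset (α × Bool) → ℝ) :
    ∑ g ∈ {insert (v, true) f, insert (v, false) f}, y g =
      y (insert (v, true) f) + y (insert (v, false) f) := by
  refine sum_pair fun he => ?_
  have : (v, true) ∈ insert (v, false) f := he ▸ mem_insert_self _ _
  simp [not_mem_of_not_mem_dom h] at this

/-- If the literal `p` holds at `A`, the excess is the indicator of the deepest term at `A`;
otherwise all values are zero. -/
theorem excess_value_nonneg {F : Finset (Finset (α × Bool))} (hF : IsTermForest F) (A : Finset α)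
    (p : α × Bool) : ∀ g ∈ F, 0 ≤ excess F (fun h => value A (insert p h)) g := by
  by_cases hp : p.2 = decide (p.1 ∈ A)
  · intro g hg
    rw [excess_eq_of_sum hF.isForest (ν := fun g => if g = deepest F A then 1 else 0) _ g hg]
    · positivity
    · intro f hf
      rw [sum_ite_eq']
      simp [value, holds_insert, hp, deepest_mem hF A, subset_deepest_iff hF hf]
  · intro g _
    simp [excess, value, holds_insert, hp]

/-- Eliminating a node `v` such that the terms containing it restrict to a forest. -/
theorem HasSystem.insert_node {v : α} {W : Finset α} {T T' F : Finset (Finset (α × Bool))}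
    {x l : ℕ} (h : HasSystem W T' x l) (hv : v ∉ W) (hF : IsTermForest F)
    (hFT : ∀ f ∈ F, f ∈ closedTerms W T') (hT' : ∀ f ∈ T', dom f ⊆ W)
    (hT : ∀ f ∈ T, f ∈ closedTerms W T' ∨ ∃ g ∈ F, ∃ b, f = insert (v, b) g) :
    HasSystem (insert v W) T (x + 2 * F.card) (l + 4 * F.card) := by
  obtain ⟨X, L, hS, hX, hL⟩ := h
  have hvC : ∀ f ∈ closedTerms W T', v ∉ dom f := fun f hf hvf =>
    hv (dom_subset_of_mem_closedTerms hT' hf hvf)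
  have hvF : ∀ f ∈ F, v ∉ dom f := fun f hf => hvC f (hFT f hf)
  set X₁ := (F ×ˢ (univ : Finset Bool)).image fun q => insert (v, q.2) q.1 with hX₁
  set pr : Finset (α × Bool) → Finset (Finset (α × Bool)) :=
    fun f => {insert (v, true) f, insert (v, false) f} with hpr
  set L₁ := F.image fun f => (pr f, ({f} : Finset (Finset (α × Bool)))) with hL₁
  set L₂ := F.image fun f => (({f} : Finset (Finset (α × Bool))), pr f) with hL₂
  set L₃ := (F ×ˢ (univ : Finset Bool)).image fun q =>
    ((children F q.1).image (fun h => insert (v, q.2) h),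
      ({insert (v, q.2) q.1} : Finset (Finset (α × Bool)))) with hL₃
  have hins : ∀ f ∈ F, ∀ b, insert (v, b) f ∈ X ∪ X₁ := fun f hf b =>
    mem_union_right _ (mem_image.2 ⟨(f, b), by simp [hf], rfl⟩)
  have hXF : ∀ f ∈ F, f ∈ X ∪ X₁ := fun f hf => mem_union_left _ (hS.mem f (hFT f hf))
  have hprX : ∀ f ∈ F, pr f ⊆ X ∪ X₁ := by
    intro f hf g hg
    simp only [hpr, mem_insert, mem_singleton] at hg
    rcases hg with rfl | rfl <;> exact hins f hf _
  have hclosed : ∀ f ∈ closedTerms (insert v W) T,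
      f ∈ closedTerms W T' ∨ ∃ g ∈ F, ∃ b, f = insert (v, b) g := by
    rintro f (h | rfl | ⟨u, hu, b, rfl⟩)
    · exact hT f h
    · exact Or.inl (Or.inr (Or.inl rfl))
    · rcases mem_insert.1 hu with rfl | hu
      -- The literals of `v` itself arise from the root of the forest.
      · exact Or.inr ⟨∅, hF.empty_mem, b, by simp⟩
      · exact Or.inl (Or.inr (Or.inr ⟨u, hu, b, rfl⟩))
  refine ⟨X ∪ X₁, L ∪ (L₁ ∪ L₂ ∪ L₃), ⟨?_, ?_, ?_, ?_⟩, ?_, ?_⟩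
  · intro c hc
    simp only [mem_union, hL₁, hL₂, hL₃, mem_image] at hc
    rcases hc with hc | (⟨f, hf, rfl⟩ | ⟨f, hf, rfl⟩) | ⟨⟨f, b⟩, hf, rfl⟩
    · exact ⟨(hS.supp c hc).1.trans subset_union_left, (hS.supp c hc).2.trans subset_union_left⟩
    · exact ⟨hprX f hf, singleton_subset_iff.2 (hXF f hf)⟩
    · exact ⟨singleton_subset_iff.2 (hXF f hf), hprX f hf⟩
    · refine ⟨image_subset_iff.2 fun h hh => hins h (mem_filter.1 hh).1 b,
        singleton_subset_iff.2 (hins f (mem_product.1 hf).1 b)⟩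
  · intro f hf
    rcases hclosed f hf with h | ⟨g, hg, b, rfl⟩
    · exact mem_union_left _ (hS.mem f h)
    · exact hins g hg b
  · intro A c hc
    have hval : ∀ f, value A (insert (v, true) f) + value A (insert (v, false) f) = value A f := by
      intro f
      by_cases hA : v ∈ A <;> simp [value, holds_insert, hA]
    simp only [mem_union, hL₁, hL₂, hL₃, mem_image] at hc
    rcases hc with hc | (⟨f, hf, rfl⟩ | ⟨f, hf, rfl⟩) | ⟨⟨f, b⟩, hf, rfl⟩
    · exact hS.sound A c hc
    · simp only [Satisfies, hpr, sum_insert_pair (hvF f hf), sum_singleton, hval, le_refl]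
    · simp only [Satisfies, hpr, sum_insert_pair (hvF f hf), sum_singleton, hval, le_refl]
    · exact (satisfies_children_iff hvF b _ f).2
        (excess_value_nonneg hF A (v, b) f (mem_product.1 hf).1)
  · intro y hy0 hy
    obtain ⟨μ', hμ', hyμ'⟩ := hS.complete y hy0 fun c hc => hy c (mem_union_left _ hc)
    obtain ⟨μ, hμ, hout, hin⟩ := exists_isProb_insert hv hF hvF hμ' (y := y)
      (fun f hf => hyμ' f (hFT f hf)) (fun f hf => by
        have h1 := hy (pr f, {f}) (by simp only [mem_union, hL₁, mem_image]; grind)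
        have h2 := hy ({f}, pr f) (by simp only [mem_union, hL₂, mem_image]; grind)
        simp only [Satisfies, hpr, sum_insert_pair (hvF f hf), sum_singleton] at h1 h2
        exact le_antisymm h1 h2) (fun b f hf => by
        refine (satisfies_children_iff hvF b _ f).1 (hy _ (mem_union_right _ (mem_union_right _
          (mem_image.2 ⟨(f, b), by simp [hf], rfl⟩))))
        )
    refine ⟨μ, hμ, fun f hf => ?_⟩
    rcases hclosed f hf with h | ⟨g, hg, b, rfl⟩
    · rw [hyμ' f h, hout f (hvC f h)]
    · exact hin b g hg
  · have : X₁.card ≤ F.card * 2 := card_image_le.trans (card_product F univ).le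
    have := card_union_le X X₁
    omega
  · have h1 : L₁.card ≤ F.card := card_image_le
    have h2 : L₂.card ≤ F.card := card_image_le
    have h3 : L₃.card ≤ F.card * 2 := card_image_le.trans (card_product F univ).le
    have := card_union_le L (L₁ ∪ L₂ ∪ L₃)
    have := card_union_le (L₁ ∪ L₂) L₃
    have := card_union_le L₁ L₂
    omega

/-- The extension of the term `f` to the variables in `M` that is true at `A`. -/
def extend (M : Finset α) (f : Finset (α × Bool)) (A : Finset α) : Finset (α × Bool) :=
  f ∪ M.image fun a => (a, decide (a ∈ A))

/-- The extensions of the term `f` to the variables in `N`. -/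
def extensions (N : Finset α) (f : Finset (α × Bool)) : Finset (Finset (α × Bool)) :=
  (N \ dom f).powerset.image (extend (N \ dom f) f)

theorem holds_extend {M A B : Finset α} {f : Finset (α × Bool)} (hA : A ⊆ M) :
    Holds B (extend M f A) ↔ Holds B f ∧ A = B ∩ M := by
  have : Holds B (extend M f A) ↔ Holds B f ∧ ∀ a ∈ M, a ∈ A ↔ a ∈ B := by
    simp only [Holds, extend, mem_union, mem_image, or_imp, forall_and, forall_exists_index,
      and_imp, forall_apply_eq_imp_iff₂, decide_eq_decide]
  rw [this, and_congr_right_iff]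
  refine fun _ => ⟨fun h => ?_, ?_⟩
  · ext a
    rw [mem_inter]
    exact ⟨fun ha => ⟨(h a (hA ha)).1 ha, hA ha⟩, fun ha => (h a ha.2).2 ha.1⟩
  · rintro rfl a ha
    simp [ha]

/-- The extensions partition the points satisfying `f`: at `B` only the one prescribed by `B` on the
missing variables can hold. -/
theorem sum_value_extensions (N : Finset α) (f : Finset (α × Bool)) (B : Finset α) :
    ∑ g ∈ extensions N f, value B g = value B f := by
  rw [extensions, sum_image]
  · have h : ∀ A ∈ (N \ dom f).powerset, value B (extend (N \ dom f) f A) =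
        if A = B ∩ (N \ dom f) then value B f else 0 := by
      intro A hA
      simp only [value, holds_extend (mem_powerset.1 hA)]
      split_ifs <;> simp_all
    rw [sum_congr rfl h, sum_ite_eq', if_pos (mem_powerset.2 inter_subset_right)]
  · intro A hA B hB hAB
    have hmem : ∀ C a, a ∈ N \ dom f → (a ∈ C ↔ (a, true) ∈ extend (N \ dom f) f C) := by
      intro C a ha
      have : (a, true) ∉ f := not_mem_of_not_mem_dom (mem_sdiff.1 ha).2 _
      simp only [extend, mem_union, mem_image, this, false_or]
      constructor
      · exact fun h => ⟨a, ha, by simp [h]⟩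
      · rintro ⟨b, _, hb⟩
        simp only [Prod.mk.injEq, decide_eq_true_eq] at hb
        exact hb.1 ▸ hb.2
    ext a
    constructor
    · intro h
      have ha := mem_powerset.1 hA h
      exact (hmem B a ha).2 (hAB ▸ (hmem A a ha).1 h)
    · intro h
      have ha := mem_powerset.1 hB h
      exact (hmem A a ha).2 (hAB ▸ (hmem B a ha).1 h)

theorem card_extensions_le (N : Finset α) (f : Finset (α × Bool)) :
    (extensions N f).card ≤ 2 ^ (N \ dom f).card :=
  card_image_le.trans (card_powerset _).le

/-- Replacing the terms in `T₁` by their extensions to `N`. -/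
theorem HasSystem.of_extensions {V N : Finset α} {T₀ T₁ : Finset (Finset (α × Bool))} {x l : ℕ}
    (h : HasSystem V (T₀ ∪ T₁.biUnion (extensions N)) x l) :
    HasSystem V (T₀ ∪ T₁) (x + T₁.card) (l + 2 * T₁.card) := by
  obtain ⟨X, L, hS, hX, hL⟩ := h
  set L₁ := T₁.image fun f => (extensions N f, ({f} : Finset (Finset (α × Bool)))) with hL₁
  set L₂ := T₁.image fun f => (({f} : Finset (Finset (α × Bool))), extensions N f) with hL₂
  have hext : ∀ f ∈ T₁, ∀ g ∈ extensions N f,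
      g ∈ closedTerms V (T₀ ∪ T₁.biUnion (extensions N)) := fun f hf g hg =>
    Or.inl (mem_union_right _ (mem_biUnion.2 ⟨f, hf, hg⟩))
  have hextX : ∀ f ∈ T₁, extensions N f ⊆ X ∪ T₁ := fun f hf g hg =>
    mem_union_left _ (hS.mem g (hext f hf g hg))
  have hclosed : ∀ f ∈ closedTerms V (T₀ ∪ T₁),
      f ∈ closedTerms V (T₀ ∪ T₁.biUnion (extensions N)) ∨ f ∈ T₁ := by
    rintro f (h | h)
    · rcases mem_union.1 h with h | h
      · exact Or.inl (Or.inl (mem_union_left _ h))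
      · exact Or.inr h
    · exact Or.inl (Or.inr h)
  refine ⟨X ∪ T₁, L ∪ (L₁ ∪ L₂), ⟨?_, ?_, ?_, ?_⟩, (card_union_le _ _).trans (by omega), ?_⟩
  · intro c hc
    simp only [mem_union, hL₁, hL₂, mem_image] at hc
    rcases hc with hc | ⟨f, hf, rfl⟩ | ⟨f, hf, rfl⟩
    · exact ⟨(hS.supp c hc).1.trans subset_union_left, (hS.supp c hc).2.trans subset_union_left⟩
    · exact ⟨hextX f hf, singleton_subset_iff.2 (mem_union_right _ hf)⟩
    · exact ⟨singleton_subset_iff.2 (mem_union_right _ hf), hextX f hf⟩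
  · intro f hf
    rcases hclosed f hf with h | h
    · exact mem_union_left _ (hS.mem f h)
    · exact mem_union_right _ h
  · intro A c hc
    simp only [mem_union, hL₁, hL₂, mem_image] at hc
    rcases hc with hc | ⟨f, hf, rfl⟩ | ⟨f, hf, rfl⟩
    · exact hS.sound A c hc
    · simp [Satisfies, sum_value_extensions]
    · simp [Satisfies, sum_value_extensions]
  · intro y hy0 hy
    obtain ⟨μ, hμ, hyμ⟩ := hS.complete y hy0 fun c hc => hy c (mem_union_left _ hc)
    refine ⟨μ, hμ, fun f hf => ?_⟩
    rcases hclosed f hf with h | h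
    · exact hyμ f h
    · have h1 : ∑ g ∈ extensions N f, y g ≤ ∑ g ∈ {f}, y g :=
        hy (extensions N f, {f}) (mem_union_right _ (mem_union_left _ (mem_image_of_mem _ h)))
      have h2 : ∑ g ∈ {f}, y g ≤ ∑ g ∈ extensions N f, y g :=
        hy ({f}, extensions N f) (mem_union_right _ (mem_union_right _ (mem_image_of_mem _ h)))
      rw [← sum_singleton y f, le_antisymm h2 h1, sum_congr rfl fun g hg => hyμ g (hext f h g hg)]
      change ∑ g ∈ extensions N f, ∑ A ∈ V.powerset, μ A * value A g = _
      rw [sum_comm]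
      exact sum_congr rfl fun A _ => by rw [← mul_sum, sum_value_extensions]
  · have h1 : L₁.card ≤ T₁.card := card_image_le
    have h2 : L₂.card ≤ T₁.card := card_image_le
    have := card_union_le L (L₁ ∪ L₂)
    have := card_union_le L₁ L₂
    omega

end System

/-! ### Nest-set elimination -/

section Elimination

variable {α : Type*} [DecidableEq α]

theorem HasSystem.mono {V : Finset α} {T T' : Finset (Finset (α × Bool))} {x x' l l' : ℕ}
    (h : HasSystem V T' x l) (hT : ∀ f ∈ T, f ∈ closedTerms V T') (hx : x ≤ x') (hl : l ≤ l') :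
    HasSystem V T x' l' := by
  obtain ⟨X, L, hS, hX, hL⟩ := h
  have hclosed : ∀ f ∈ closedTerms V T, f ∈ closedTerms V T' := by
    rintro f (h | h)
    · exact hT f h
    · exact Or.inr h
  refine ⟨X, L, ⟨hS.supp, fun f hf => hS.mem f (hclosed f hf), hS.sound, fun y h0 hy => ?_⟩,
    hX.trans hx, hL.trans hl⟩
  obtain ⟨μ, hμ, hyμ⟩ := hS.complete y h0 hy
  exact ⟨μ, hμ, fun f hf => hyμ f (hclosed f hf)⟩

theorem restrict_restrict (N M : Finset α) (f : Finset (α × Bool)) :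
    restrict N (restrict M f) = restrict (M ∪ N) f := by
  ext p
  simp [restrict, and_assoc]

theorem eq_insert_restrict {A : Finset α} {f : Finset (α × Bool)} (hA : Holds A f) {v : α}
    (hv : v ∈ dom f) : f = insert (v, decide (v ∈ A)) (restrict {v} f) := by
  have hmem : (v, decide (v ∈ A)) ∈ f := by
    obtain ⟨⟨w, b⟩, hp, rfl⟩ := mem_image.1 hv
    have := hA _ hp
    dsimp only at this ⊢
    rwa [← this]
  ext ⟨a, b⟩
  simp only [restrict, mem_insert, mem_filter, mem_singleton, Prod.mk.injEq]
  constructor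
  · intro h
    by_cases hav : a = v
    · subst hav
      exact Or.inl ⟨rfl, hA _ h⟩
    · exact Or.inr ⟨h, hav⟩
  · rintro (⟨rfl, rfl⟩ | h)
    · exact hmem
    · exact h.1

theorem isTermForest_insert_empty {T : Finset (Finset (α × Bool))}
    (hsat : ∀ f ∈ T, ∃ A, Holds A f)
    (hchain : ∀ f ∈ T, ∀ g ∈ T, dom f ⊆ dom g ∨ dom g ⊆ dom f) :
    IsTermForest (insert ∅ T) where
  empty_mem := mem_insert_self _ _
  sat f hf := by
    rcases mem_insert.1 hf with rfl | hf
    · exact ⟨∅, holds_empty _⟩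
    · exact hsat f hf
  chain A f hf g hg hAf hAg := by
    rcases mem_insert.1 hf with rfl | hf
    · exact Or.inl (empty_subset _)
    rcases mem_insert.1 hg with rfl | hg
    · exact Or.inr (empty_subset _)
    exact (hchain f hf g hg).imp (subset_of_holds hAf hAg) (subset_of_holds hAg hAf)

theorem subset_of_sdiff_subset_sdiff {a b c : Finset α} (h : a \ c ⊆ b \ c) (hc : c ⊆ b) :
    a ⊆ b := fun x hx =>
  if hxc : x ∈ c then hc hxc else (mem_sdiff.1 (h (mem_sdiff.2 ⟨hx, hxc⟩))).1

/-- Eliminating one by one the nodes of a set `N` contained in all terms in `T₁`, which are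
nested outside `N`. -/
theorem HasSystem.union_nodes {W : Finset α} {T' T₀ : Finset (Finset (α × Bool))} {x l m : ℕ}
    (h : HasSystem W T' x l)
    (hT₀ : ∀ f ∈ T₀, f ∈ closedTerms W T') (hT₀W : ∀ f ∈ T₀, dom f ⊆ W) (N : Finset α) :
    ∀ T₁ : Finset (Finset (α × Bool)), T₁.card ≤ m → Disjoint N W →
      (∀ f ∈ T₁, ∃ A, Holds A f) → (∀ f ∈ T₁, N ⊆ dom f ∧ dom f ⊆ N ∪ W) →
      (∀ f ∈ T₁, ∀ g ∈ T₁, dom f \ N ⊆ dom g \ N ∨ dom g \ N ⊆ dom f \ N) →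
      (∀ f ∈ T₁, restrict N f ∈ closedTerms W T') →
      HasSystem (N ∪ W) (T₀ ∪ T₁) (x + N.card * (2 * (m + 1))) (l + N.card * (4 * (m + 1))) := by
  induction N using Finset.induction_on with
  | empty =>
    intro T₁ _ _ _ _ _ hres
    rw [empty_union]
    refine h.mono (fun f hf => ?_) (by simp) (by simp)
    rcases mem_union.1 hf with hf | hf
    · exact hT₀ f hf
    · simpa only [restrict_empty] using hres f hf
  | insert v N hvN ih =>
    intro T₁ hm hdisj hsat hdom hchain hres
    have hvW : v ∉ W := disjoint_left.1 hdisj (mem_insert_self _ _)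
    have hvNW : v ∉ N ∪ W := by simp [hvN, hvW]
    set T₂ := T₁.image (restrict {v}) with hT₂
    have hsat₂ : ∀ f ∈ T₂, ∃ A, Holds A f := by
      intro f hf
      obtain ⟨f, hf', rfl⟩ := mem_image.1 hf
      obtain ⟨A, hA⟩ := hsat f hf'
      exact ⟨A, hA.mono (restrict_subset _ _)⟩
    have hdom₂ : ∀ f ∈ T₂, N ⊆ dom f ∧ dom f ⊆ N ∪ W := by
      intro f hf
      obtain ⟨f, hf', rfl⟩ := mem_image.1 hf
      have := hdom f hf'
      rw [dom_restrict]
      constructor <;> grind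
    have hchain₂ : ∀ f ∈ T₂, ∀ g ∈ T₂, dom f \ N ⊆ dom g \ N ∨ dom g \ N ⊆ dom f \ N := by
      intro f hf g hg
      obtain ⟨f, hf', rfl⟩ := mem_image.1 hf
      obtain ⟨g, hg', rfl⟩ := mem_image.1 hg
      simpa only [dom_restrict, sdiff_sdiff_left, sup_eq_union, ← insert_eq] using
        hchain f hf' g hg'
    have h₂ := ih T₂ (card_image_le.trans hm)
      (disjoint_of_subset_left (subset_insert _ _) hdisj) hsat₂ hdom₂ hchain₂ (by
        intro f hf
        obtain ⟨f, hf', rfl⟩ := mem_image.1 hf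
        rw [restrict_restrict, ← insert_eq]
        exact hres f hf')
    -- With `v` removed, all domains still contain the rest of `N` and are nested outside it, hence
    -- nested. The added root accounts for `m + 1`.
    have hF : IsTermForest (insert ∅ T₂) := by
      refine isTermForest_insert_empty hsat₂ fun f hf g hg => ?_
      have h1 := (hdom₂ f hf).1
      have h2 := (hdom₂ g hg).1
      rcases hchain₂ f hf g hg with h | h
      · exact Or.inl (subset_of_sdiff_subset_sdiff h h2)
      · exact Or.inr (subset_of_sdiff_subset_sdiff h h1)
    have h₃ := h₂.insert_node (T := T₀ ∪ T₁) hvNW hF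
      (by
        intro f hf
        rcases mem_insert.1 hf with rfl | hf
        · exact Or.inr (Or.inl rfl)
        · exact Or.inl (mem_union_right _ hf))
      (by
        intro f hf
        rcases mem_union.1 hf with hf | hf
        · exact (hT₀W f hf).trans subset_union_right
        · exact (hdom₂ f hf).2)
      (by
        intro f hf
        rcases mem_union.1 hf with hf | hf
        · exact Or.inl (Or.inl (mem_union_left _ hf))
        · obtain ⟨A, hA⟩ := hsat f hf
          exact Or.inr ⟨restrict {v} f, mem_insert_of_mem (mem_image_of_mem _ hf), _,
            eq_insert_restrict hA ((hdom f hf).1 (mem_insert_self _ _))⟩)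
    have hcard : (insert ∅ T₂).card ≤ m + 1 :=
      (card_insert_le _ _).trans (Nat.succ_le_succ (card_image_le.trans hm))
    rw [insert_union]
    refine h₃.mono (fun f hf => Or.inl hf) ?_ ?_
    · rw [card_insert_of_notMem hvN]
      linarith
    · rw [card_insert_of_notMem hvN]
      linarith

theorem dom_extend {M : Finset α} (f : Finset (α × Bool)) (A : Finset α) :
    dom (extend M f A) = dom f ∪ M := by
  rw [dom, extend, image_union, image_image]
  congr 1
  exact image_id

theorem restrict_extend {N M : Finset α} (hM : M ⊆ N) (f : Finset (α × Bool)) (A : Finset α) :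
    restrict N (extend M f A) = restrict N f := by
  rw [restrict, extend, filter_union, ← restrict, filter_eq_empty_iff.2, union_empty]
  intro p hp
  obtain ⟨a, ha, rfl⟩ := mem_image.1 hp
  exact not_not.2 (hM ha)

theorem exists_holds_extend {M A B : Finset α} {f : Finset (α × Bool)} (hM : Disjoint (dom f) M)
    (hB : Holds B f) (hA : A ⊆ M) : ∃ B', Holds B' (extend M f A) := by
  refine ⟨B \ M ∪ A, (holds_extend hA).2 ⟨(holds_congr fun a ha => ?_).1 hB, ?_⟩⟩
  · have : a ∉ M := disjoint_left.1 hM ha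
    have : a ∉ A := fun h => this (hA h)
    simp [*]
  · ext a
    simp only [mem_inter, mem_union, mem_sdiff]
    exact ⟨fun h => ⟨Or.inr h, hA h⟩, by tauto⟩

/-- The terms of `T` after the deletion of the nodes in `N`. -/
def deleteTerms (N : Finset α) (T : Finset (Finset (α × Bool))) : Finset (Finset (α × Bool)) :=
  (T.image (restrict N)).filter fun f => 2 ≤ f.card

/-- Deletion drops remainders with fewer than two literals. Nothing is lost, since the empty term
and single literals always belong to `closedTerms`. -/
theorem restrict_mem_closedTerms {V N : Finset α} {T : Finset (Finset (α × Bool))}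
    {f : Finset (α × Bool)} (hf : f ∈ T) (hfV : dom f ⊆ V) :
    restrict N f ∈ closedTerms (V \ N) (deleteTerms N T) := by
  have hdom : dom (restrict N f) ⊆ V \ N := dom_restrict N f ▸ sdiff_subset_sdiff hfV Subset.rfl
  rcases Nat.lt_or_ge (restrict N f).card 2 with h | h
  · rcases Nat.lt_or_ge (restrict N f).card 1 with h | h'
    · exact Or.inr (Or.inl (card_eq_zero.1 (by omega)))
    · obtain ⟨⟨v, b⟩, hvb⟩ := card_eq_one.1 (show (restrict N f).card = 1 by omega)
      rw [hvb] at hdom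
      exact Or.inr (Or.inr ⟨v, hdom (by simp [dom]), b, hvb⟩)
  · exact Or.inl (mem_filter.2 ⟨mem_image_of_mem _ hf, h⟩)

theorem restrict_eq_self {N : Finset α} {f : Finset (α × Bool)} (h : Disjoint (dom f) N) :
    restrict N f = f :=
  filter_eq_self.2 fun _ hp => disjoint_left.1 h (mem_image_of_mem _ hp)

/-- Eliminating a nest-set. -/
theorem HasSystem.of_delete {G : FinHypergraph α} {N : Finset α} (hN : G.IsNestSet N) {k m : ℕ}
    (hk : G.gap N ≤ k) {T : Finset (Finset (α × Bool))} (hm : T.card ≤ m)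
    (hsat : ∀ f ∈ T, ∃ A, Holds A f) (hdom : ∀ f ∈ T, dom f ∈ G.edges) {x l : ℕ}
    (h : HasSystem (G.nodes \ N) (deleteTerms N T) x l) :
    HasSystem G.nodes T (x + N.card * (3 * (2 ^ k * m) + 2))
      (l + N.card * (6 * (2 ^ k * m) + 4)) := by
  set T₁ := T.filter fun f => (dom f ∩ N).Nonempty with hT₁
  set T₀ := T.filter fun f => ¬ (dom f ∩ N).Nonempty with hT₀
  have hT : T₀ ∪ T₁ = T := by rw [union_comm]; exact filter_union_filter_not_eq _ _
  have hV : ∀ f ∈ T, dom f ⊆ G.nodes := fun f hf => G.subset_nodes _ (hdom f hf)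
  have hdisj : ∀ f ∈ T₀, Disjoint (dom f) N := fun f hf =>
    disjoint_iff_inter_eq_empty.2 (not_nonempty_iff_eq_empty.1 (mem_filter.1 hf).2)
  set T₂ := T₁.biUnion (extensions N) with hT₂
  have hmem₂ : ∀ g ∈ T₂, ∃ f ∈ T₁, ∃ A ⊆ N \ dom f, extend (N \ dom f) f A = g := by
    intro g hg
    obtain ⟨f, hf, hg⟩ := mem_biUnion.1 hg
    obtain ⟨A, hA, rfl⟩ := mem_image.1 hg
    exact ⟨f, hf, A, mem_powerset.1 hA, rfl⟩
  have hcard₁ : T₁.card ≤ m := (card_filter_le _ _).trans hm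
  have hcard₂ : T₂.card ≤ 2 ^ k * m := by
    -- The number of variables of `N` missing from `f` is `|N| - |dom f ∩ N|`, which the gap bounds.
    refine (card_biUnion_le_card_mul _ _ (2 ^ k) fun f hf => ?_).trans ?_
    · refine (card_extensions_le N f).trans (Nat.pow_le_pow_right (by norm_num) (le_trans ?_ hk))
      rw [card_sdiff]
      exact Finset.le_sup (f := fun e => N.card - (e ∩ N).card)
        (mem_filter.2 ⟨hdom f (mem_filter.1 hf).1, (mem_filter.1 hf).2⟩)
    · rw [mul_comm]
      exact Nat.mul_le_mul_left _ hcard₁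
  have hNV : N ∪ G.nodes \ N = G.nodes := union_sdiff_of_subset hN.1
  have h₂ : HasSystem (N ∪ G.nodes \ N) (T₀ ∪ T₂)
      (x + N.card * (2 * (2 ^ k * m + 1))) (l + N.card * (4 * (2 ^ k * m + 1))) := by
    refine h.union_nodes ?_ ?_ N T₂ hcard₂ disjoint_sdiff ?_ ?_ ?_ ?_
    · intro f hf
      have := restrict_mem_closedTerms (N := N) (mem_filter.1 hf).1 (hV f (mem_filter.1 hf).1)
      rwa [restrict_eq_self (hdisj f hf)] at this
    · exact fun f hf => subset_sdiff.2 ⟨hV f (mem_filter.1 hf).1, hdisj f hf⟩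
    · intro g hg
      obtain ⟨f, hf, A, hA, rfl⟩ := hmem₂ g hg
      obtain ⟨B, hB⟩ := hsat f (mem_filter.1 hf).1
      exact exists_holds_extend disjoint_sdiff hB hA
    · intro g hg
      obtain ⟨f, hf, A, hA, rfl⟩ := hmem₂ g hg
      rw [dom_extend, hNV, union_sdiff_self_eq_union]
      exact ⟨subset_union_right, union_subset (hV f (mem_filter.1 hf).1) hN.1⟩
    · intro g hg g' hg'
      obtain ⟨f, hf, A, hA, rfl⟩ := hmem₂ g hg
      obtain ⟨f', hf', A', hA', rfl⟩ := hmem₂ g' hg'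
      rw [mem_filter] at hf hf'
      simp only [dom_extend, union_sdiff_self_eq_union, union_sdiff_right]
      exact hN.2.total ⟨_, hdom f hf.1, hf.2, rfl⟩ ⟨_, hdom f' hf'.1, hf'.2, rfl⟩
    · intro g hg
      obtain ⟨f, hf, A, hA, rfl⟩ := hmem₂ g hg
      rw [restrict_extend sdiff_subset]
      exact restrict_mem_closedTerms (mem_filter.1 hf).1 (hV f (mem_filter.1 hf).1)
  rw [hNV] at h₂
  have h₃ := h₂.of_extensions
  rw [hT] at h₃
  -- The expanded terms are charged to the nodes of `N`; if `N` is empty, no term meets it.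
  have hcard : T₁.card ≤ N.card * (2 ^ k * m) := by
    rcases N.eq_empty_or_nonempty with rfl | hne
    · simp [hT₁]
    · have h1 : 1 ≤ N.card * 2 ^ k := Nat.mul_pos hne.card_pos (by positivity)
      calc T₁.card ≤ 1 * m := by omega
        _ ≤ N.card * 2 ^ k * m := Nat.mul_le_mul_right _ h1
        _ = _ := mul_assoc _ _ _
  refine h₃.mono (fun f hf => Or.inl hf) ?_ ?_ <;> linarith

/-- Deleting nodes can only merge or drop terms, so one bound `m` serves throughout. The costs add
up because `|V| = |V \ N| + |N|`; the leading `1` is the variable of the empty term. -/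
theorem hasSystem_of_elimOrder (k m : ℕ) (L : List (Finset α)) :
    ∀ (G : FinHypergraph α) (T : Finset (Finset (α × Bool))), G.IsNestSetElimOrder L →
      G.nsgOf L ≤ k → T.card ≤ m → (∀ f ∈ T, ∃ A, Holds A f) → (∀ f ∈ T, dom f ∈ G.edges) →
      HasSystem G.nodes T (1 + G.nodes.card * (3 * (2 ^ k * m) + 2))
        (G.nodes.card * (6 * (2 ^ k * m) + 4)) := by
  induction L with
  | nil =>
    intro G T hL _ _ _ hdom
    have hV : G.nodes = ∅ := hL
    have hT : T = ∅ := eq_empty_of_forall_notMem fun f hf => by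
      have h1 := G.subset_nodes _ (hdom f hf)
      have h2 := G.two_le_card _ (hdom f hf)
      rw [hV, subset_empty] at h1
      simp [h1] at h2
    rw [hV, hT]
    exact hasSystem_empty.mono (fun f hf => Or.inl hf) (by simp) (by simp)
  | cons N L ih =>
    intro G T hL hk hm hsat hdom
    have hk' : max (G.gap N) ((G.delete N).nsgOf L) ≤ k := hk
    have h := ih (G.delete N) (deleteTerms N T) hL.2 ((le_max_right _ _).trans hk')
      ((card_filter_le _ _).trans (card_image_le.trans hm))
      (by
        intro f hf
        obtain ⟨f, hf', rfl⟩ := mem_image.1 (mem_filter.1 hf).1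
        obtain ⟨A, hA⟩ := hsat f hf'
        exact ⟨A, hA.mono (restrict_subset _ _)⟩)
      (by
        intro f hf
        obtain ⟨hf, h2⟩ := mem_filter.1 hf
        obtain ⟨f, hf', rfl⟩ := mem_image.1 hf
        obtain ⟨A, hA⟩ := hsat f hf'
        rw [← card_dom (hA.mono (restrict_subset _ _))] at h2
        rw [dom_restrict] at h2 ⊢
        exact mem_filter.2 ⟨mem_image_of_mem (fun e => e \ N) (hdom f hf'), h2⟩)
    have h' := h.of_delete hL.1 ((le_max_left _ _).trans hk') hm hsat hdom
    have hcard : G.nodes.card = (G.delete N).nodes.card + N.card :=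
      (card_sdiff_add_card_eq_card hL.1.1).symm
    refine h'.mono (fun f hf => Or.inl hf) ?_ ?_ <;> rw [hcard] <;> linarith

end Elimination

/-! ### The extended formulation -/

section Formulation

theorem ExtendedFormulation.exists_of_fintype {ι κ ρ : Type*} [Fintype ι] [Fintype κ] [Fintype ρ]
    {P : Set (ι → ℝ)} (A : ρ → ι → ℝ) (B : ρ → κ → ℝ) (b : ρ → ℝ)
    (h : ∀ z, z ∈ P ↔ ∃ y : κ → ℝ, ∀ i, ∑ j, A i j * z j + ∑ j, B i j * y j ≤ b i)
    (hA : ∀ i j, A i j ∈ ({-1, 0, 1} : Set ℝ)) (hB : ∀ i j, B i j ∈ ({-1, 0, 1} : Set ℝ))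
    (hb : ∀ i, b i ∈ ({-1, 0, 1} : Set ℝ)) :
    ∃ F : ExtendedFormulation P, F.numVars = Fintype.card ι + Fintype.card κ ∧
      F.numIneqs = Fintype.card ρ ∧ F.IsZeroPmOne := by
  let eκ := (Fintype.equivFin κ).symm
  let eρ := (Fintype.equivFin ρ).symm
  refine ⟨⟨Fintype.card κ, Fintype.card ρ, fun i j => A (eρ i) j, fun i j => B (eρ i) (eκ j),
    fun i => b (eρ i), fun z => ?_⟩, rfl, rfl, fun i j => hA _ _, fun i j => hB _ _, fun i => hb _⟩
  have key : ∀ (y : κ → ℝ) i, ∑ j, B i (eκ j) * y (eκ j) = ∑ j, B i j * y j := fun y i =>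
    eκ.sum_comp fun j => B i j * y j
  rw [h]
  constructor
  · rintro ⟨y, hy⟩
    refine ⟨fun j => y (eκ j), fun i => ?_⟩
    simpa [Matrix.mulVec, dotProduct, key] using hy (eρ i)
  · rintro ⟨y, hy⟩
    refine ⟨fun j => y (eκ.symm j), fun i => ?_⟩
    have := hy (eρ.symm i)
    simpa [Matrix.mulVec, dotProduct, ← key] using this

variable {α : Type*} [DecidableEq α]

/-- The term of a signed edge. -/
def SignedEdge.term (s : SignedEdge α) : Finset (α × Bool) :=
  s.edge.attach.image fun v => (v.1, decide (s.sign v = 1))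

theorem SignedEdge.dom_term (s : SignedEdge α) : dom s.term = s.edge := by
  rw [dom, term, image_image]
  exact attach_image_val

theorem SignedEdge.holds_term {s : SignedEdge α} {A : Finset α} :
    Holds A s.term ↔ ∀ v ∈ s.edge.attach, (s.sign v = 1 ↔ v.1 ∈ A) := by
  simp only [Holds, term, forall_mem_image, decide_eq_decide]

theorem SignedEdge.exists_holds (s : SignedEdge α) : ∃ A, Holds A s.term := by
  refine ⟨(s.edge.attach.filter fun v => s.sign v = 1).image Subtype.val,
    SignedEdge.holds_term.2 fun v _ => ?_⟩
  simp

theorem value_singleton_true (A : Finset α) (v : α) :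
    value A {(v, true)} = if v ∈ A then 1 else 0 := by
  simp [value, Holds]

theorem SignedEdge.value_term (s : SignedEdge α) (A : Finset α) :
    value A s.term = ∏ v : {v // v ∈ s.edge}, literal (s.sign v) (value A {(v.1, true)}) := by
  have h : ∀ v : {v // v ∈ s.edge}, literal (s.sign v) (value A {(v.1, true)}) =
      if s.sign v = 1 ↔ v.1 ∈ A then 1 else 0 := by
    intro v
    rw [value_singleton_true, literal]
    by_cases h1 : s.sign v = 1 <;> by_cases h2 : v.1 ∈ A <;> simp [h1, h2]
  simp only [h]
  rw [prod_ite_zero]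
  simp only [value, holds_term, univ_eq_attach, prod_const_one]

namespace SignedHypergraph

/-- The term of a coordinate of the pseudo-Boolean polytope. -/
def coordTerm (H : SignedHypergraph α) : H.Coord → Finset (α × Bool) :=
  Sum.elim (fun v => {(v.1, true)}) fun s => s.1.term

theorem pseudoBooleanSet_eq (H : SignedHypergraph α) :
    H.pseudoBooleanSet = {z | ∃ A ⊆ H.nodes, ∀ i, z i = value A (H.coordTerm i)} := by
  ext z
  constructor
  · rintro ⟨h01, hz⟩
    classical
    have hV : ∀ v : {v // v ∈ H.nodes}, z (Sum.inl v) =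
        value (((univ : Finset {v // v ∈ H.nodes}).filter fun v => z (Sum.inl v) = 1).image
          Subtype.val) {(v.1, true)} := by
      intro v
      rw [value_singleton_true]
      rcases h01 (Sum.inl v) with h | h <;> simp [h]
    refine ⟨((univ : Finset {v // v ∈ H.nodes}).filter fun v => z (Sum.inl v) = 1).image
      Subtype.val, ?_, ?_⟩
    · intro v hv
      obtain ⟨v, -, rfl⟩ := mem_image.1 hv
      exact v.2
    · rintro (v | s)
      · exact hV v
      · rw [hz s]
        refine Eq.trans ?_ (s.1.value_term _).symm
        exact prod_congr rfl fun v _ => by rw [hV]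
  · rintro ⟨A, -, hA⟩
    refine ⟨fun i => ?_, fun s => ?_⟩
    · rw [hA, value]
      split_ifs <;> simp
    · simp only [hA]
      exact s.1.value_term A

/-- The weights of a convex combination of 0/1 points form a probability measure on their supports,
and the coordinates are its moments. -/
theorem mem_pseudoBooleanPolytope (H : SignedHypergraph α) (z : H.Coord → ℝ) :
    z ∈ H.pseudoBooleanPolytope ↔
      ∃ μ, IsProb H.nodes μ ∧ ∀ i, z i = moment H.nodes μ (H.coordTerm i) := by
  constructor
  · intro hz
    refine convexHull_min (t := {z : H.Coord → ℝ | ∃ μ, IsProb H.nodes μ ∧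
      ∀ i, z i = moment H.nodes μ (H.coordTerm i)}) ?_ ?_ hz
    · rw [pseudoBooleanSet_eq]
      rintro z ⟨A, hA, hz⟩
      have hA := mem_powerset.2 hA
      refine ⟨fun B => if B = A then 1 else 0, ⟨fun B => by positivity, ?_⟩, fun i => ?_⟩
      · rw [sum_ite_eq', if_pos hA]
      · simp [moment, hz, ite_mul, mem_powerset.1 hA]
    · rintro z ⟨μ, hμ, hz⟩ z' ⟨μ', hμ', hz'⟩ a b ha hb hab
      refine ⟨fun A => a * μ A + b * μ' A, ⟨fun A => ?_, ?_⟩, fun i => ?_⟩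
      · have := hμ.nonneg A
        have := hμ'.nonneg A
        positivity
      · rw [sum_add_distrib, ← mul_sum, ← mul_sum, hμ.sum_eq, hμ'.sum_eq]
        linarith
      · simp only [Pi.add_apply, Pi.smul_apply, smul_eq_mul, hz, hz', moment, mul_sum,
          ← sum_add_distrib]
        exact sum_congr rfl fun A _ => by ring
  · rintro ⟨μ, hμ, hz⟩
    have h : z = ∑ A ∈ H.nodes.powerset, μ A • fun i => value A (H.coordTerm i) := by
      ext i
      simp [hz, moment]
    rw [h]
    refine (convex_convexHull ℝ _).sum_mem (fun A _ => hμ.nonneg A) hμ.sum_eq fun A hA => ?_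
    refine subset_convexHull ℝ _ ?_
    rw [pseudoBooleanSet_eq]
    exact ⟨A, mem_powerset.1 hA, fun _ => rfl⟩

end SignedHypergraph

theorem satisfies_moment {V : Finset α} {μ : Finset α → ℝ} (hμ : IsProb V μ)
    {c : Finset (Finset (α × Bool)) × Finset (Finset (α × Bool))}
    (hc : ∀ A, Satisfies (value A) c) : Satisfies (moment V μ) c := by
  have h : ∀ P : Finset (Finset (α × Bool)), ∑ f ∈ P, moment V μ f =
      ∑ A ∈ V.powerset, μ A * ∑ f ∈ P, value A f := by
    intro P
    simp only [moment, mul_sum]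
    exact sum_comm
  rw [Satisfies, h, h]
  exact sum_le_sum fun A _ => mul_le_mul_of_nonneg_left (hc A) (hμ.nonneg A)

/-- The coefficient of `y_f` in the inequality coded by `c`. -/
def constraintCoeff (c : Finset (Finset (α × Bool)) × Finset (Finset (α × Bool)))
    (f : Finset (α × Bool)) : ℝ :=
  (if f ∈ c.1 then 1 else 0) - if f ∈ c.2 then 1 else 0

theorem sum_constraintCoeff {X : Finset (Finset (α × Bool))}
    {c : Finset (Finset (α × Bool)) × Finset (Finset (α × Bool))} (hc : c.1 ⊆ X ∧ c.2 ⊆ X)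
    (y : Finset (α × Bool) → ℝ) :
    ∑ f : {f // f ∈ X}, constraintCoeff c f.1 * y f.1 = ∑ f ∈ c.1, y f - ∑ f ∈ c.2, y f := by
  rw [sum_coe_sort X fun f => constraintCoeff c f * y f]
  simp only [constraintCoeff, sub_mul, ite_mul, one_mul, zero_mul, sum_sub_distrib]
  rw [← sum_filter, ← sum_filter, filter_mem_eq_inter, filter_mem_eq_inter,
    inter_eq_right.2 hc.1, inter_eq_right.2 hc.2]

/-- The sign `1` or `-1`, for the two inequalities of an equation. -/
def boolSign (s : Bool) : ℝ := if s then 1 else -1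

theorem forall_boolSign_mul_le {a b : ℝ} : (∀ s, boolSign s * a ≤ boolSign s * b) ↔ a = b := by
  simp only [Bool.forall_bool, boolSign]
  constructor
  · rintro ⟨h1, h2⟩
    simp only [Bool.false_eq_true, if_false, if_true] at h1 h2
    linarith
  · rintro rfl
    exact ⟨le_rfl, le_rfl⟩

theorem HasSystem.exists_extendedFormulation {H : SignedHypergraph α} {x l : ℕ}
    (h : HasSystem H.nodes (H.edges.image SignedEdge.term) x l) :
    ∃ F : ExtendedFormulation H.pseudoBooleanPolytope,
      F.numVars ≤ H.nodes.card + H.edges.card + x ∧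
      F.numIneqs ≤ l + 2 + 2 * (H.nodes.card + H.edges.card) ∧ F.IsZeroPmOne := by
  classical
  obtain ⟨X, L, hS, hX, hL⟩ := h
  have hcoord : ∀ i, H.coordTerm i ∈ closedTerms H.nodes (H.edges.image SignedEdge.term) := by
    rintro (v | s)
    · exact Or.inr (Or.inr ⟨v.1, v.2, true, rfl⟩)
    · exact Or.inl (mem_image_of_mem _ s.2)
  -- The rows are the inequalities of `L`, the equation `y ∅ = 1`, and the equations linking each `z
  -- i` to its term; the `Bool` factors split equations into two inequalities.
  let A : {c // c ∈ L} ⊕ Bool ⊕ H.Coord × Bool → H.Coord → ℝ := Sum.elim (fun _ _ => 0)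
    (Sum.elim (fun _ _ => 0) fun q j => if j = q.1 then boolSign q.2 else 0)
  let B : {c // c ∈ L} ⊕ Bool ⊕ H.Coord × Bool → {f // f ∈ X} → ℝ :=
    Sum.elim (fun c f => constraintCoeff c.1 f.1)
      (Sum.elim (fun s f => if f.1 = ∅ then boolSign s else 0)
        fun q f => if f.1 = H.coordTerm q.1 then -boolSign q.2 else 0)
  let b : {c // c ∈ L} ⊕ Bool ⊕ H.Coord × Bool → ℝ := Sum.elim (fun _ => 0)
    (Sum.elim boolSign fun _ => 0)
  have hB : ∀ (y : Finset (α × Bool) → ℝ) (f : Finset (α × Bool)) (_ : f ∈ X) (t : ℝ),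
      ∑ g : {g // g ∈ X}, (if g.1 = f then t else 0) * y g.1 = t * y f := by
    intro y f hf t
    rw [sum_coe_sort X fun g => (if g = f then t else 0) * y g]
    simp [ite_mul, hf]
  have hrows : ∀ (z : H.Coord → ℝ) (y : Finset (α × Bool) → ℝ),
      (∀ i, ∑ j, A i j * z j + ∑ j, B i j * y j.1 ≤ b i) ↔
        (∀ c ∈ L, Satisfies y c) ∧ y ∅ = 1 ∧ ∀ i, z i = y (H.coordTerm i) := by
    intro z y
    rw [Sum.forall, Sum.forall]
    refine and_congr ?_ (and_congr ?_ ?_)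
    · rw [Subtype.forall]
      refine forall₂_congr fun c hc => ?_
      simp only [A, B, b, Sum.elim_inl, zero_mul, sum_const_zero, zero_add,
        sum_constraintCoeff (hS.supp c hc), Satisfies, sub_nonpos]
    · rw [← forall_boolSign_mul_le]
      refine forall_congr' fun s => ?_
      simp only [A, B, b, Sum.elim_inl, Sum.elim_inr, zero_mul, sum_const_zero, zero_add,
        hB y ∅ (hS.mem ∅ (Or.inr (Or.inl rfl))), mul_one]
    · rw [Prod.forall]
      refine forall_congr' fun i => ?_
      rw [← forall_boolSign_mul_le]
      refine forall_congr' fun s => ?_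
      simp only [A, B, b, Sum.elim_inr, hB y _ (hS.mem _ (hcoord i))]
      simp only [ite_mul, zero_mul, sum_ite_eq', mem_univ, if_true]
      constructor <;> intro h <;> linarith
  obtain ⟨F, hF₁, hF₂, hF₃⟩ := ExtendedFormulation.exists_of_fintype
    (P := H.pseudoBooleanPolytope) A B b (fun z => by
      rw [H.mem_pseudoBooleanPolytope]
      constructor
      · rintro ⟨μ, hμ, hz⟩
        refine ⟨fun f => moment H.nodes μ f.1, (hrows z _).2 ⟨fun c hc =>
          satisfies_moment hμ fun A => hS.sound A c hc, ?_, hz⟩⟩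
        simpa [moment] using hμ.sum_eq
      · rintro ⟨y, hy⟩
        -- Extending by zero is harmless, as only terms in `X` occur in the rows.
        let y' : Finset (α × Bool) → ℝ := fun f => if hf : f ∈ X then y ⟨f, hf⟩ else 0
        have hy' : ∀ f : {f // f ∈ X}, y f = y' f.1 := fun f => by simp [y']
        simp only [hy'] at hy
        obtain ⟨h1, h2, h3⟩ := (hrows z y').1 hy
        obtain ⟨μ, hμ, hyμ⟩ := hS.complete y' h2 h1
        exact ⟨μ, hμ, fun i => by rw [h3, hyμ _ (hcoord i)]⟩)
    (by
      rintro (c | s | ⟨i, s⟩) j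
      · simp [A]
      · simp [A]
      · simp only [A, Sum.elim_inr, boolSign]
        split_ifs <;> simp)
    (by
      rintro (c | s | ⟨i, s⟩) j
      · simp only [B, Sum.elim_inl, constraintCoeff]
        split_ifs <;> simp
      · simp only [B, Sum.elim_inl, Sum.elim_inr, boolSign]
        split_ifs <;> simp
      · simp only [B, Sum.elim_inr, boolSign]
        split_ifs <;> simp)
    (by
      rintro (c | s | ⟨i, s⟩)
      · simp [b]
      · cases s <;> simp [b, boolSign]
      · simp [b])
  refine ⟨F, ?_, ?_, hF₃⟩
  · rw [hF₁]
    simpa using hX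
  · rw [hF₂]
    simp only [Fintype.card_sum, Fintype.card_coe, Fintype.card_bool, Fintype.card_prod]
    omega

theorem exists_extendedFormulation_of_nsg_le (H : SignedHypergraph α) {k : ℕ}
    (hk : H.underlying.nsg ≤ k) :
    ∃ F : ExtendedFormulation H.pseudoBooleanPolytope,
      F.numVars ≤ H.nodes.card + H.edges.card +
        (1 + H.nodes.card * (3 * (2 ^ k * H.edges.card) + 2)) ∧
      F.numIneqs ≤ H.nodes.card * (6 * (2 ^ k * H.edges.card) + 4) + 2 +
        2 * (H.nodes.card + H.edges.card) ∧ F.IsZeroPmOne := by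
  obtain ⟨L₀, hL₀⟩ := H.underlying.exists_isNestSetElimOrder
  obtain ⟨L, hL, hLk⟩ := Nat.sInf_mem (s := {g : ℕ | ∃ L : List (Finset α),
    H.underlying.IsNestSetElimOrder L ∧ H.underlying.nsgOf L = g}) ⟨_, L₀, hL₀, rfl⟩
  refine HasSystem.exists_extendedFormulation (hasSystem_of_elimOrder k H.edges.card L
    H.underlying (H.edges.image SignedEdge.term) hL (hLk.le.trans hk) card_image_le ?_ ?_)
  · intro f hf
    obtain ⟨s, -, rfl⟩ := mem_image.1 hf
    exact s.exists_holds
  · intro f hf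
    obtain ⟨s, hs, rfl⟩ := mem_image.1 hf
    rw [s.dom_term]
    exact mem_image_of_mem _ hs

/-- Uses `2 ≤ e` and rounds `c` up to a natural exponent. The `+ 1` covers `P = 0`, where the
logarithm is `0` and so `k = 0`. -/
theorem two_pow_le_of_le_log {c : ℝ} {k P : ℕ} (h : (k : ℝ) ≤ c * Real.log P) :
    2 ^ k ≤ P ^ ⌈c⌉₊ + 1 := by
  rcases Nat.eq_zero_or_pos P with rfl | hP
  · have : k = 0 := by simpa using h
    simp [this]
  · have hP' : (1 : ℝ) ≤ P := by exact_mod_cast hP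
    have h1 : (k : ℝ) ≤ ⌈c⌉₊ * Real.log P :=
      h.trans (mul_le_mul_of_nonneg_right (Nat.le_ceil c) (Real.log_nonneg hP'))
    have h2 : (2 : ℝ) ^ k ≤ (P : ℝ) ^ ⌈c⌉₊ := by
      calc (2 : ℝ) ^ k ≤ Real.exp 1 ^ k :=
            pow_le_pow_left₀ (by norm_num) (by linarith [Real.add_one_le_exp 1]) k
        _ = Real.exp k := by rw [← Real.exp_nat_mul, mul_one]
        _ ≤ Real.exp (⌈c⌉₊ * Real.log P) := Real.exp_le_exp.2 h1
        _ = (P : ℝ) ^ ⌈c⌉₊ := by rw [Real.exp_nat_mul, Real.exp_log (by positivity)]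
    have h3 : 2 ^ k ≤ P ^ ⌈c⌉₊ := by exact_mod_cast h2
    omega

theorem mvPolynomial_eval_mono {σ : Type*} (p : MvPolynomial σ ℕ) {a b : σ → ℕ} (h : a ≤ b) :
    MvPolynomial.eval a p ≤ MvPolynomial.eval b p := by
  simp only [MvPolynomial.eval_eq]
  exact sum_le_sum fun d _ => Nat.mul_le_mul_left _
    (prod_le_prod' fun i _ => Nat.pow_le_pow_left (h i) _)

end Formulation

end PseudoBoolean

theorem mainTheorem1 :
    -- the bound `O(r 2^k |V| |S|)`, with an absolute constant `C`
    (∃ C : ℕ, ∀ (α : Type*) [DecidableEq α] (H : PseudoBoolean.SignedHypergraph α) (r k : ℕ),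
      H.edges.Nonempty → H.rank = r → H.underlying.nsg ≤ k →
      ∃ F : PseudoBoolean.ExtendedFormulation H.pseudoBooleanPolytope,
        F.numVars ≤ C * (r * 2 ^ k * H.nodes.card * H.edges.card) ∧
        F.numIneqs ≤ C * (r * 2 ^ k * H.nodes.card * H.edges.card) ∧
        F.IsZeroPmOne) ∧
    -- polynomial size if `k = O(log poly(|V|, |E|))`
    (∀ (c : ℝ) (p : MvPolynomial (Fin 2) ℕ), ∃ q : MvPolynomial (Fin 2) ℕ,
      ∀ (α : Type*) [DecidableEq α] (H : PseudoBoolean.SignedHypergraph α) (k : ℕ),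
      H.underlying.nsg ≤ k →
      (k : ℝ) ≤ c * Real.log
        (MvPolynomial.eval ![H.underlying.nodes.card, H.underlying.edges.card] p : ℕ) →
      ∃ F : PseudoBoolean.ExtendedFormulation H.pseudoBooleanPolytope,
        F.numVars ≤ MvPolynomial.eval ![H.nodes.card, H.edges.card] q ∧
        F.numIneqs ≤ MvPolynomial.eval ![H.nodes.card, H.edges.card] q ∧
        F.IsZeroPmOne) := by
  constructor
  -- The inequality count gives `16 = 6 + 4 + 2 + 2 + 2`, since `|V|`, `|S|` and `1` are all at most
  -- `r * 2 ^ k * |V| * |S|`.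
  · refine ⟨16, fun α _ H r k hne hr hk => ?_⟩
    obtain ⟨F, hv, hi, hF⟩ := PseudoBoolean.exists_extendedFormulation_of_nsg_le H hk
    obtain ⟨s, hs⟩ := hne
    have hm : 1 ≤ H.edges.card := Finset.card_pos.2 ⟨s, hs⟩
    have hn : 1 ≤ H.nodes.card := le_trans (by norm_num)
      ((H.two_le_card s hs).trans (Finset.card_le_card (H.subset_nodes s hs)))
    have hr1 : 1 ≤ r := hr ▸ le_trans (by norm_num)
      ((H.two_le_card s hs).trans (Finset.le_sup (f := fun s => s.edge.card) hs))
    have h2 : 1 ≤ 2 ^ k := Nat.one_le_two_pow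
    generalize H.nodes.card = n at *
    generalize H.edges.card = m at *
    generalize 2 ^ k = t at *
    have hQ : t * n * m ≤ r * t * n * m := by
      simpa [mul_assoc] using Nat.mul_le_mul_right (t * (n * m)) hr1
    have h3 : n * m ≤ t * n * m := by
      simpa [mul_assoc] using Nat.mul_le_mul_right (n * m) h2
    have h4 : n ≤ n * m := Nat.le_mul_of_pos_right n hm
    have h5 : m ≤ n * m := Nat.le_mul_of_pos_left m hn
    have h6 : n * (t * m) = t * n * m := by ring
    refine ⟨F, hv.trans ?_, hi.trans ?_, hF⟩ <;> linarith
  · intro c p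
    -- This is the inequality count with `2 ^ k` replaced by its polynomial bound; it also dominates
    -- the variable count.
    refine ⟨MvPolynomial.X 0 * (6 * ((p ^ ⌈c⌉₊ + 1) * MvPolynomial.X 1) + 4) + 2 +
      2 * (MvPolynomial.X 0 + MvPolynomial.X 1), fun α _ H k hk hkc => ?_⟩
    obtain ⟨F, hv, hi, hF⟩ := PseudoBoolean.exists_extendedFormulation_of_nsg_le H hk
    have hE : H.underlying.edges.card ≤ H.edges.card := Finset.card_image_le
    have hmono : MvPolynomial.eval ![H.underlying.nodes.card, H.underlying.edges.card] p ≤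
        MvPolynomial.eval ![H.nodes.card, H.edges.card] p := by
      refine PseudoBoolean.mvPolynomial_eval_mono p fun i => ?_
      fin_cases i
      · exact le_rfl
      · exact hE
    have h2 : 2 ^ k ≤ MvPolynomial.eval ![H.nodes.card, H.edges.card] p ^ ⌈c⌉₊ + 1 :=
      (PseudoBoolean.two_pow_le_of_le_log hkc).trans (Nat.succ_le_succ (Nat.pow_le_pow_left hmono _))
    have h3 := Nat.mul_le_mul_left H.nodes.card (Nat.mul_le_mul_right H.edges.card h2)
    refine ⟨F, hv.trans ?_, hi.trans ?_, hF⟩ <;>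
    · simp only [map_add, map_mul, map_pow, map_one, map_ofNat, MvPolynomial.eval_X,
        Matrix.cons_val_zero, Matrix.cons_val_one]
      generalize MvPolynomial.eval ![H.nodes.card, H.edges.card] p ^ ⌈c⌉₊ = t at *
      nlinarith
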